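/- Let $n\ge 2$ and let $D\subsetneq\mathbb{R}^n$ be a domain (a nonempty connected open set), with Euclidean diameter $d(D)\in(0,\infty]$, and let $\delta_D(z)$ denote the distance from $z$ to the boundary $\partial D$. For $x,y\in D$ put $$m_D(x,y)=\inf_{\gamma}\int_\gamma \frac{d(D)}{\delta_D(z)\,(d(D)-\delta_D(z))}\,|dz|,$$ where the infimum is over all rectifiable paths $\gamma$ joining $x$ to $y$ in $D$, and where the density is understood as $1/\delta_D(z)$ if $D$ is unbounded, and put $$j_D(x,y)=\frac12\log\left\{\left(1+\frac{|x-y|}{\delta_D(x)}\right)\left(1+\frac{|x-y|}{\delta_D(y)}\right)\right\}.$$ The domain $D$ is called uniform if there is a constant $c\ge 1$ such that any two points $z_1,z_2\in D$ can be joined by a rectifiable arc $\gamma$ in $D$ with $\ell(\gamma)\le c\,|z_1-z_2|$ and $\min_{j=1,2}\ell(\gamma(z_j,z))\le c\,\delta_D(z)$ for all $z\in\gamma$, where $\ell$ denotes length and $\gamma(z_j,z)$ is the part of $\gamma$ between $z_j$ and $z$. Then $D$ is uniform if and only if there exists a constant $c_1\ge 1$ such that $m_D(x,y)\le c_1\,j_D(x,y)$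 for all $x,y\in D$. -/

import Mathlib

open Set MeasureTheory
open scoped ENNReal

namespace HypMetric

/-- `ℝⁿ` with the Euclidean norm. -/
abbrev E (n : ℕ) := EuclideanSpace ℝ (Fin n)

variable {n : ℕ}

/-- A domain: a nonempty connected open set. -/
def IsDomainSet (D : Set (E n)) : Prop := IsOpen D ∧ IsConnected D

/-- The distance `δ_D(z)` from `z` to the boundary of `D`. -/
noncomputable def bdist (D : Set (E n)) (z : E n) : ℝ := Metric.infDist z (frontier D)

open Classical in
/-- The density `m_D(z) = d(D) / (δ_D(z) (d(D) - δ_D(z)))`, where `d(D)` is the diameter of `D`.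
For unbounded `D`, i.e. `d(D) = ∞`, it is read as its limit `1 / δ_D(z)`. -/
noncomputable def mDensity (D : Set (E n)) (z : E n) : ℝ :=
  if Bornology.IsBounded D then
    Metric.diam D / (bdist D z * (Metric.diam D - bdist D z))
  else 1 / bdist D z

/-- The length of the path `γ : [a, b] → ℝⁿ`. -/
noncomputable def pathLength (γ : ℝ → E n) (a b : ℝ) : ℝ≥0∞ := eVariationOn γ (Icc a b)

/-- `γ : [a, b] → D` is a rectifiable path in `D` joining `x` to `y`. -/
structure IsRectPath (D : Set (E n)) (x y : E n) (γ : ℝ → E n) (a b : ℝ) : Prop where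
  le : a ≤ b
  continuousOn : ContinuousOn γ (Icc a b)
  mapsTo : MapsTo γ (Icc a b) D
  left : γ a = x
  right : γ b = y
  rectifiable : pathLength γ a b ≠ ∞

/-- The line integral `∫_γ ρ |dz|` of a nonnegative density `ρ` along a rectifiable path
`γ : [a, b] → ℝⁿ`, i.e. the integral of `ρ` along the parametrization of `γ` by arc length. -/
noncomputable def lineIntegral (ρ : E n → ℝ) (γ : ℝ → E n) (a b : ℝ) : ℝ≥0∞ :=
  ∫⁻ s in Icc 0 (pathLength γ a b).toReal,
    ENNReal.ofReal (ρ (naturalParameterization γ (Icc a b) a s))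

/-- The distance `m_D(x, y)`: the infimum of `∫_γ m_D(z) |dz|` over all rectifiable paths `γ`
joining `x` to `y` in `D`. -/
noncomputable def mDist (D : Set (E n)) (x y : E n) : ℝ≥0∞ :=
  ⨅ (γ : ℝ → E n) (a : ℝ) (b : ℝ) (_ : IsRectPath D x y γ a b), lineIntegral (mDensity D) γ a b

/-- The distance ratio metric `j_D`. -/
noncomputable def jDist (D : Set (E n)) (x y : E n) : ℝ :=
  1 / 2 * Real.log ((1 + dist x y / bdist D x) * (1 + dist x y / bdist D y))

/-- `D` is uniform: for some `c ≥ 1`, any two points of `D` can be joined by a rectifiable arc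
(an injective path, constant if the points coincide) in `D` that satisfies the double `c`-cone
condition and the quasi-convexity condition. -/
def IsUniform (D : Set (E n)) : Prop :=
  ∃ c : ℝ, 1 ≤ c ∧ ∀ x ∈ D, ∀ y ∈ D, ∃ (γ : ℝ → E n) (a b : ℝ),
    IsRectPath D x y γ a b ∧ InjOn γ (Icc a b) ∧
    (∀ t ∈ Icc a b,
      min (pathLength γ a t) (pathLength γ t b) ≤ ENNReal.ofReal (c * bdist D (γ t))) ∧
    pathLength γ a b ≤ ENNReal.ofReal (c * dist x y)

end HypMetric

/-! A ball of radius `δ_D(z)` about `z ∈ D` lies in `D`, so `2 δ_D ≤ d(D)` and the density of `m_D`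
lies between `1/δ_D` and `2/δ_D`. Hence it suffices to study the quasihyperbolic length `qhInt` of
paths parametrized by arc length.

If `D` is uniform, the cone condition and the Lipschitz property of `δ_D` give `δ_D(x) + w ≤ (2c+1)
δ_D(f w)` at arc length `w` from `x`, up to the midpoint of the arc. Integrating `1/δ_D` over the
two halves produces the two logarithms in `j_D` (`IsUnitPath.qhInt_le_jDist`).

Conversely, join `x` and `y` by an arc that is quasihyperbolically shortest up to a small additive
error. Its subpaths are almost shortest too, so the hypothesis, applied to their endpoints, bounds
each of them by `c j_D + 1`. On a piece where `δ_D ≤ m`, with `δ_D ≥ m/2` at both ends, the ratio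
`X` of length to `m` then satisfies `X ≤ c log(1 + 2X) + 1` and is bounded
(`IsUnitPath.length_le_of_bdist_le`). Summing over dyadic levels of `δ_D`, and using Harnack's
inequality, gives the cone condition. For quasiconvexity, Harnack suffices when the endpoints are
close compared with `δ_D`; otherwise the cone condition bounds the two end pieces and Harnack the
middle one. -/

theorem continuousOn_variationOnFromTo {F : Type*} [PseudoEMetricSpace F] {f : ℝ → F} {s : Set ℝ}
    (hf : BoundedVariationOn f s) (hc : ContinuousOn f s) {a : ℝ} (as : a ∈ s) :
    ContinuousOn (variationOnFromTo f s a) s := by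
  intro x hx
  have h1 := hf.tendsto_eVariationOn_Icc_zero_left ((hc x hx).mono inter_subset_left)
  have h2 := hf.tendsto_eVariationOn_Icc_zero_right x ((hc x hx).mono inter_subset_left)
  have h3 := ((ENNReal.tendsto_toReal ENNReal.zero_ne_top).comp h1).add
    ((ENNReal.tendsto_toReal ENNReal.zero_ne_top).comp h2)
  simp only [ENNReal.toReal_zero, add_zero, Function.comp_apply] at h3
  refine tendsto_iff_dist_tendsto_zero.2 (squeeze_zero' (.of_forall fun _ => dist_nonneg) ?_ h3)
  filter_upwards [self_mem_nhdsWithin] with y hy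
  rw [Real.dist_eq, variationOnFromTo.sub_right hf.locallyBoundedVariationOn as hy hx]
  rcases le_total x y with h | h
  · rw [variationOnFromTo.eq_of_le _ _ h, abs_of_nonneg ENNReal.toReal_nonneg]
    exact le_add_of_nonneg_left ENNReal.toReal_nonneg
  · rw [variationOnFromTo.eq_of_ge _ _ h, abs_neg, abs_of_nonneg ENNReal.toReal_nonneg]
    exact le_add_of_nonneg_right ENNReal.toReal_nonneg

theorem hasUnitSpeedOn_Icc_iff {F : Type*} [PseudoEMetricSpace F] {f : ℝ → F} {p q : ℝ} :
    HasUnitSpeedOn f (Icc p q) ↔ ∀ ⦃u v⦄, p ≤ u → u ≤ v → v ≤ q →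
      eVariationOn f (Icc u v) = ENNReal.ofReal (v - u) := by
  rw [HasUnitSpeedOn, hasConstantSpeedOnWith_iff_ordered]
  constructor
  · intro h u v hu huv hv
    have := h ⟨hu, huv.trans hv⟩ ⟨hu.trans huv, hv⟩ huv
    rwa [inter_eq_right.2 (Icc_subset_Icc hu hv), NNReal.coe_one, one_mul] at this
  · intro h u hu v hv huv
    rw [inter_eq_right.2 (Icc_subset_Icc hu.1 hv.2), NNReal.coe_one, one_mul]
    exact h hu.1 huv hv.2

theorem HasUnitSpeedOn.mono_Icc {F : Type*} [PseudoEMetricSpace F] {f : ℝ → F} {p q p' q' : ℝ}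
    (h : HasUnitSpeedOn f (Icc p q)) (hp : p ≤ p') (hq : q' ≤ q) :
    HasUnitSpeedOn f (Icc p' q') := by
  rw [hasUnitSpeedOn_Icc_iff] at h ⊢
  exact fun u v hu huv hv => h (hp.trans hu) huv (hv.trans hq)

theorem HasUnitSpeedOn.congr_Icc {F : Type*} [PseudoEMetricSpace F] {f g : ℝ → F} {p q : ℝ}
    (h : HasUnitSpeedOn f (Icc p q)) (hfg : EqOn f g (Icc p q)) :
    HasUnitSpeedOn g (Icc p q) := by
  rw [hasUnitSpeedOn_Icc_iff] at h ⊢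
  intro u v hu huv hv
  rw [← h hu huv hv, eVariationOn.congr (hfg.mono (Icc_subset_Icc hu hv))]

theorem HasUnitSpeedOn.comp_add_const {F : Type*} [PseudoEMetricSpace F] {f : ℝ → F} {p q : ℝ}
    (h : HasUnitSpeedOn f (Icc p q)) (c : ℝ) :
    HasUnitSpeedOn (fun u => f (u + c)) (Icc (p - c) (q - c)) := by
  rw [hasUnitSpeedOn_Icc_iff] at h ⊢
  intro u v hu huv hv
  have h1 := eVariationOn.comp_eq_of_monotoneOn f (t := Icc u v) (fun w => w + c)
    (fun a _ b _ hab => by simpa using hab)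
  rw [image_add_const_Icc, h (by linarith) (by linarith) (by linarith)] at h1
  rw [show v - u = v + c - (u + c) by ring, ← h1]
  rfl

/-! ### Arc length parametrization, concatenation and segments -/

namespace HypMetric
variable {n : ℕ} {D : Set (E n)} {x y z : E n} {f g : ℝ → E n} {L M : ℝ}

/-- `f` is a path from `x` to `y` in `D`, parametrized by arc length on `[0, L]`. -/
structure IsUnitPath (D : Set (E n)) (x y : E n) (f : ℝ → E n) (L : ℝ) : Prop where
  nonneg : 0 ≤ L
  unitSpeed : HasUnitSpeedOn f (Icc 0 L)
  mapsTo : MapsTo f (Icc 0 L) D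
  left : f 0 = x
  right : f L = y

theorem IsUnitPath.pathLength_eq (h : IsUnitPath D x y f L) {s t : ℝ} (hs : 0 ≤ s) (hst : s ≤ t)
    (ht : t ≤ L) : pathLength f s t = ENNReal.ofReal (t - s) :=
  hasUnitSpeedOn_Icc_iff.1 h.unitSpeed hs hst ht

theorem IsUnitPath.dist_le (h : IsUnitPath D x y f L) {s t : ℝ} (hs : 0 ≤ s) (hst : s ≤ t)
    (ht : t ≤ L) : dist (f s) (f t) ≤ t - s := by
  have h1 : edist (f s) (f t) ≤ ENNReal.ofReal (t - s) := by
    rw [← h.pathLength_eq hs hst ht]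
    exact eVariationOn.edist_le f ⟨le_rfl, hst⟩ ⟨hst, le_rfl⟩
  rw [edist_dist] at h1
  exact (ENNReal.ofReal_le_ofReal_iff (by linarith)).1 h1

theorem IsUnitPath.continuousOn (h : IsUnitPath D x y f L) : ContinuousOn f (Icc 0 L) := by
  have : LipschitzOnWith 1 f (Icc 0 L) := LipschitzOnWith.of_dist_le_mul fun s hs t ht => by
    rcases le_total s t with hst | hst
    · simpa [Real.dist_eq, abs_of_nonpos (sub_nonpos.2 hst)] using h.dist_le hs.1 hst ht.2
    · rw [dist_comm]
      simpa [Real.dist_eq, abs_of_nonneg (sub_nonneg.2 hst)] using h.dist_le ht.1 hst hs.2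
  exact this.continuousOn

theorem IsUnitPath.isRectPath (h : IsUnitPath D x y f L) : IsRectPath D x y f 0 L where
  le := h.nonneg
  continuousOn := h.continuousOn
  mapsTo := h.mapsTo
  left := h.left
  right := h.right
  rectifiable := by simp [h.pathLength_eq le_rfl h.nonneg le_rfl]

theorem IsUnitPath.eqOn_naturalParameterization (h : IsUnitPath D x y f L) :
    EqOn (naturalParameterization f (Icc 0 L) 0) f (Icc 0 L) := by
  intro s hs
  have h0 : (0 : ℝ) ∈ Icc 0 L := ⟨le_rfl, h.nonneg⟩
  have h1 := (hasConstantSpeedOnWith_iff_variationOnFromTo_eq.1 h.unitSpeed)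
  have h2 := edist_naturalParameterization_eq_zero h1.1 h0 hs
  rwa [h1.2 h0 hs, NNReal.coe_one, one_mul, sub_zero, edist_eq_zero] at h2

theorem IsUnitPath.lineIntegral_eq (h : IsUnitPath D x y f L) (ρ : E n → ℝ) :
    lineIntegral ρ f 0 L = ∫⁻ s in Icc 0 L, ENNReal.ofReal (ρ (f s)) := by
  rw [lineIntegral, h.pathLength_eq le_rfl h.nonneg le_rfl, sub_zero,
    ENNReal.toReal_ofReal h.nonneg]
  exact setLIntegral_congr_fun measurableSet_Icc fun s hs => by
    simp only [h.eqOn_naturalParameterization hs]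

theorem variationOnFromTo_eq_pathLength (f : ℝ → E n) {a b t : ℝ}
    (ht : t ∈ Icc a b) : variationOnFromTo f (Icc a b) a t = (pathLength f a t).toReal := by
  rw [variationOnFromTo.eq_of_le _ _ ht.1, inter_eq_right.2 (Icc_subset_Icc le_rfl ht.2),
    pathLength]

/-- Continuity of the path makes its arc length function continuous, so no length is skipped. This
matters because the natural parametrization has unit speed only on the image of that function. -/
theorem IsRectPath.image_variation {a b : ℝ} (h : IsRectPath D x y f a b) :
    variationOnFromTo f (Icc a b) a '' Icc a b = Icc 0 (pathLength f a b).toReal := by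
  have ha : a ∈ Icc a b := ⟨le_rfl, h.le⟩
  have hbv : BoundedVariationOn f (Icc a b) := h.rectifiable
  have hb := variationOnFromTo_eq_pathLength f ⟨h.le, le_rfl⟩
  apply subset_antisymm
  · rintro _ ⟨t, ht, rfl⟩
    have hm := variationOnFromTo.monotoneOn hbv.locallyBoundedVariationOn ha
    rw [← hb]
    exact ⟨variationOnFromTo.nonneg_of_le _ _ ht.1, hm ht ⟨h.le, le_rfl⟩ ht.2⟩
  · have := intermediate_value_Icc h.le (continuousOn_variationOnFromTo hbv h.continuousOn ha)
    rwa [hb, variationOnFromTo.self] at this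

theorem IsRectPath.naturalParameterization_apply {a b : ℝ} (h : IsRectPath D x y f a b) {t : ℝ}
    (ht : t ∈ Icc a b) :
    naturalParameterization f (Icc a b) a (pathLength f a t).toReal = f t := by
  have hbv : BoundedVariationOn f (Icc a b) := h.rectifiable
  rw [← edist_eq_zero, ← variationOnFromTo_eq_pathLength f ht]
  exact edist_naturalParameterization_eq_zero hbv.locallyBoundedVariationOn ⟨le_rfl, h.le⟩ ht

theorem IsRectPath.exists_eq_toReal {a b : ℝ} (h : IsRectPath D x y f a b) {s : ℝ}
    (hs : s ∈ Icc 0 (pathLength f a b).toReal) : ∃ t ∈ Icc a b, (pathLength f a t).toReal = s := by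
  rw [← h.image_variation] at hs
  obtain ⟨t, ht, rfl⟩ := hs
  exact ⟨t, ht, (variationOnFromTo_eq_pathLength f ht).symm⟩

theorem IsRectPath.isUnitPath {a b : ℝ} (h : IsRectPath D x y f a b) :
    IsUnitPath D x y (naturalParameterization f (Icc a b) a) (pathLength f a b).toReal where
  nonneg := ENNReal.toReal_nonneg
  unitSpeed := by
    rw [← h.image_variation]
    exact has_unit_speed_naturalParameterization f
      (BoundedVariationOn.locallyBoundedVariationOn h.rectifiable) ⟨le_rfl, h.le⟩
  mapsTo := by
    intro s hs
    obtain ⟨t, ht, rfl⟩ := h.exists_eq_toReal hs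
    rw [h.naturalParameterization_apply ht]
    exact h.mapsTo ht
  left := by
    have := h.naturalParameterization_apply ⟨le_rfl, h.le⟩
    rwa [pathLength, Icc_self, eVariationOn.subsingleton f subsingleton_singleton,
      ENNReal.toReal_zero, h.left] at this
  right := by rw [h.naturalParameterization_apply ⟨h.le, le_rfl⟩, h.right]

theorem IsUnitPath.sub (h : IsUnitPath D x y f L) {s t : ℝ} (hs : 0 ≤ s) (hst : s ≤ t)
    (ht : t ≤ L) : IsUnitPath D (f s) (f t) (fun u => f (u + s)) (t - s) where
  nonneg := by linarith
  unitSpeed := by simpa using (h.unitSpeed.mono_Icc hs ht).comp_add_const s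
  mapsTo := fun u hu => h.mapsTo ⟨by linarith [hu.1], by linarith [hu.2]⟩
  left := by simp
  right := by simp

/-- The concatenation of a path parametrized by `[0, L]` with a second path. -/
noncomputable def concat (f g : ℝ → E n) (L : ℝ) (s : ℝ) : E n :=
  if s ≤ L then f s else g (s - L)

theorem concat_of_le {s : ℝ} (h : s ≤ L) : concat f g L s = f s := if_pos h

theorem concat_of_ge (hfg : f L = g 0) {s : ℝ} (h : L ≤ s) : concat f g L s = g (s - L) := by
  rcases h.eq_or_lt with rfl | h
  · simp [concat, hfg]
  · exact if_neg h.not_ge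

theorem IsUnitPath.trans (hf : IsUnitPath D x y f L) (hg : IsUnitPath D y z g M) :
    IsUnitPath D x z (concat f g L) (L + M) where
  nonneg := add_nonneg hf.nonneg hg.nonneg
  unitSpeed := by
    refine HasUnitSpeedOn.Icc_Icc (y := L) (hf.unitSpeed.congr_Icc fun s hs => ?_) ?_
    · rw [concat_of_le hs.2]
    · have := hg.unitSpeed.comp_add_const (-L)
      rw [sub_neg_eq_add, zero_add, sub_neg_eq_add, add_comm M] at this
      refine this.congr_Icc fun s hs => ?_
      rw [concat_of_ge (hf.right.trans hg.left.symm) hs.1, sub_eq_add_neg]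
  mapsTo := by
    intro s hs
    rcases le_total s L with h | h
    · rw [concat_of_le h]; exact hf.mapsTo ⟨hs.1, h⟩
    · rw [concat_of_ge (hf.right.trans hg.left.symm) h]
      exact hg.mapsTo ⟨by linarith, by linarith [hs.2]⟩
  left := by rw [concat_of_le hf.nonneg, hf.left]
  right := by
    rw [concat_of_ge (hf.right.trans hg.left.symm) (le_add_of_nonneg_right hg.nonneg),
      add_sub_cancel_left, hg.right]

/-- The segment from `p` to `q`, parametrized by arc length on `[0, dist p q]`. -/
noncomputable def seg (p q : E n) (s : ℝ) : E n := p + (s / dist p q) • (q - p)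

theorem dist_seg_seg {p q : E n} (hpq : p ≠ q) (s t : ℝ) :
    dist (seg p q s) (seg p q t) = |s - t| := by
  have h : 0 < dist p q := dist_pos.2 hpq
  rw [seg, seg, dist_add_left, dist_eq_norm, ← sub_smul, norm_smul, ← sub_div, norm_div,
    Real.norm_eq_abs, Real.norm_of_nonneg h.le, ← dist_eq_norm, dist_comm q p]
  field_simp

theorem seg_zero (p q : E n) : seg p q 0 = p := by simp [seg]

theorem seg_dist (p q : E n) : seg p q (dist p q) = q := by
  rcases eq_or_ne p q with rfl | h
  · simp [seg]
  · simp [seg, div_self (dist_ne_zero.2 h)]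

theorem injective_seg {p q : E n} (hpq : p ≠ q) : Function.Injective (seg p q) := fun s t h => by
  have := dist_seg_seg hpq s t
  rw [h, dist_self] at this
  exact sub_eq_zero.1 (abs_eq_zero.1 this.symm)

theorem hasUnitSpeedOn_seg {p q : E n} (hpq : p ≠ q) (a b : ℝ) :
    HasUnitSpeedOn (seg p q) (Icc a b) := by
  rw [hasUnitSpeedOn_Icc_iff]
  intro u v _ huv _
  have h1 : eVariationOn (seg p q) (Icc u v) = eVariationOn (id : ℝ → ℝ) (Icc u v) := by
    simp only [eVariationOn, edist_dist, dist_seg_seg hpq, id, Real.dist_eq]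
  rw [h1, eVariationOn_id_Icc]

theorem isUnitPath_seg {p q : E n} (h : ∀ s ∈ Icc 0 (dist p q), seg p q s ∈ D) :
    IsUnitPath D p q (seg p q) (dist p q) where
  nonneg := dist_nonneg
  unitSpeed := by
    rcases eq_or_ne p q with rfl | hpq
    · rw [dist_self, Icc_self]
      exact hasConstantSpeedOnWith_of_subsingleton _ subsingleton_singleton _
    · exact hasUnitSpeedOn_seg hpq _ _
  mapsTo := h
  left := seg_zero p q
  right := seg_dist p q

end HypMetric

/-! ### Distance to the boundary and comparison of the densities -/

namespace HypMetric
variable {n : ℕ} {D : Set (E n)} {x y z : E n} {f g : ℝ → E n} {L M : ℝ}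

theorem IsDomainSet.frontier_nonempty (hD : IsDomainSet D) (hne : D ≠ univ) :
    (frontier D).Nonempty := by
  rw [nonempty_iff_ne_empty, Ne, ← isClopen_iff_frontier_eq_empty, isClopen_iff]
  rintro (h | h)
  · exact hD.2.nonempty.ne_empty h
  · exact hne h

theorem bdist_nonneg : 0 ≤ bdist D z := Metric.infDist_nonneg

theorem bdist_pos (hD : IsDomainSet D) (hne : D ≠ univ) (hz : z ∈ D) : 0 < bdist D z := by
  refine (isClosed_frontier.notMem_iff_infDist_pos (hD.frontier_nonempty hne)).1 fun h => ?_
  rw [hD.1.frontier_eq] at h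
  exact h.2 hz

theorem bdist_le_add_dist (z w : E n) : bdist D z ≤ bdist D w + dist z w :=
  Metric.infDist_le_infDist_add_dist

theorem continuous_bdist : Continuous (bdist D) := Metric.continuous_infDist_pt _

/-- The open ball misses the boundary, so otherwise `D` and the complement of its closure would
disconnect it. -/
theorem ball_bdist_subset (hD : IsOpen D) (hz : z ∈ D) : Metric.ball z (bdist D z) ⊆ D := by
  intro w hw
  by_contra hwD
  have hfr : ∀ v ∈ Metric.ball z (bdist D z), v ∈ closure D → v ∈ D := by
    intro v hv hvc
    by_contra hvD
    have := Metric.infDist_le_dist_of_mem (x := z) (s := frontier D) (y := v)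
      (by rw [hD.frontier_eq]; exact ⟨hvc, hvD⟩)
    rw [Metric.mem_ball, dist_comm] at hv
    exact absurd hv this.not_gt
  have hc : IsPreconnected (Metric.ball z (bdist D z)) := (convex_ball _ _).isPreconnected
  have hz' : z ∈ Metric.ball z (bdist D z) := Metric.mem_ball_self
    (dist_nonneg.trans_lt (Metric.mem_ball.1 hw))
  obtain ⟨v, -, hvD, hvc⟩ := hc D (closure D)ᶜ hD isClosed_closure.isOpen_compl
    (fun v hv => or_iff_not_imp_right.2 fun h => hfr v hv (not_not.1 h))
    ⟨z, hz', hz⟩ ⟨w, hw, fun h => hwD (hfr w hw h)⟩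
  exact hvc (subset_closure hvD)

/-- `D` contains nearly antipodal points `z ± r v` of the ball about `z`, for every `r < δ_D(z)`. -/
theorem two_mul_bdist_le_diam (hn : 1 ≤ n) (hD : IsOpen D) (hb : Bornology.IsBounded D) (hz : z ∈ D) :
    2 * bdist D z ≤ Metric.diam D := by
  obtain ⟨v, hv⟩ : ∃ v : E n, ‖v‖ = 1 :=
    ⟨EuclideanSpace.single ⟨0, hn⟩ 1, by simp⟩
  have key : ∀ r, 0 ≤ r → r < bdist D z → 2 * r ≤ Metric.diam D := by
    intro r hr0 hr
    have h1 : z + r • v ∈ D := ball_bdist_subset hD hz (by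
      simpa [norm_smul, hv, abs_of_nonneg hr0] using hr)
    have h2 : z - r • v ∈ D := ball_bdist_subset hD hz (by
      simpa [norm_smul, hv, abs_of_nonneg hr0] using hr)
    have h3 := Metric.dist_le_diam_of_mem hb h1 h2
    rwa [dist_eq_norm, show z + r • v - (z - r • v) = (2 * r) • v by module, norm_smul, hv,
      mul_one, Real.norm_of_nonneg (by positivity)] at h3
  by_contra! hlt
  have h0 : 0 ≤ Metric.diam D := Metric.diam_nonneg
  have := key ((Metric.diam D / 2 + bdist D z) / 2) (by linarith [bdist_nonneg (D := D) (z := z)])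
    (by linarith)
  linarith

theorem one_div_bdist_le_mDensity (hn : 1 ≤ n) (hD : IsDomainSet D) (hne : D ≠ univ)
    (hz : z ∈ D) : 1 / bdist D z ≤ mDensity D z := by
  rw [mDensity]
  split_ifs with hb
  · have h1 := bdist_pos hD hne hz
    have h2 := two_mul_bdist_le_diam hn hD.1 hb hz
    rw [div_le_div_iff₀ h1 (mul_pos h1 (by linarith))]
    nlinarith
  · exact le_rfl

theorem mDensity_le (hn : 1 ≤ n) (hD : IsDomainSet D) (hne : D ≠ univ) (hz : z ∈ D) :
    mDensity D z ≤ 2 / bdist D z := by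
  have h1 := bdist_pos hD hne hz
  rw [mDensity]
  split_ifs with hb
  · have h2 := two_mul_bdist_le_diam hn hD.1 hb hz
    rw [div_le_div_iff₀ (mul_pos h1 (by linarith)) h1]
    nlinarith
  · gcongr
    norm_num

/-- The quasihyperbolic length of the part of `f` over `[s, t]`. -/
noncomputable def qhInt (D : Set (E n)) (f : ℝ → E n) (s t : ℝ) : ℝ :=
  ∫ u in s..t, 1 / bdist D (f u)

/-! ### Quasihyperbolic length and almost shortest arcs -/

section
variable (hD : IsDomainSet D) (hne : D ≠ univ)
include hD hne

theorem IsUnitPath.continuousOn_one_div (h : IsUnitPath D x y f L) :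
    ContinuousOn (fun u => 1 / bdist D (f u)) (Icc 0 L) :=
  continuousOn_const.div (continuous_bdist.comp_continuousOn h.continuousOn) fun _ hu =>
    (bdist_pos hD hne (h.mapsTo hu)).ne'

theorem IsUnitPath.intervalIntegrable (h : IsUnitPath D x y f L) {s t : ℝ} (hs : s ∈ Icc 0 L)
    (ht : t ∈ Icc 0 L) : IntervalIntegrable (fun u => 1 / bdist D (f u)) volume s t :=
  ((h.continuousOn_one_div hD hne).mono
    (ordConnected_Icc.uIcc_subset hs ht)).intervalIntegrable

theorem IsUnitPath.qhInt_add (h : IsUnitPath D x y f L) {s t u : ℝ} (hs : s ∈ Icc 0 L)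
    (ht : t ∈ Icc 0 L) (hu : u ∈ Icc 0 L) :
    qhInt D f s t + qhInt D f t u = qhInt D f s u :=
  intervalIntegral.integral_add_adjacent_intervals (h.intervalIntegrable hD hne hs ht)
    (h.intervalIntegrable hD hne ht hu)

omit hD hne in
theorem qhInt_nonneg {s t : ℝ} (hst : s ≤ t) : 0 ≤ qhInt D f s t :=
  intervalIntegral.integral_nonneg hst fun _ _ => one_div_nonneg.2 bdist_nonneg

theorem IsUnitPath.lineIntegral_one_div (h : IsUnitPath D x y f L) :
    lineIntegral (fun z => 1 / bdist D z) f 0 L = ENNReal.ofReal (qhInt D f 0 L) := by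
  rw [h.lineIntegral_eq, qhInt, intervalIntegral.integral_of_le h.nonneg,
    ← integral_Icc_eq_integral_Ioc, ofReal_integral_eq_lintegral_ofReal]
  · exact (h.continuousOn_one_div hD hne).integrableOn_Icc
  · exact .of_forall fun _ => one_div_nonneg.2 bdist_nonneg

omit hD hne in
theorem qhInt_comp_add (s t : ℝ) :
    qhInt D (fun u => f (u + s)) 0 (t - s) = qhInt D f s t := by
  rw [qhInt, intervalIntegral.integral_comp_add_right (fun u => 1 / bdist D (f u)),
    zero_add, sub_add_cancel, qhInt]

theorem IsUnitPath.qhInt_concat (hf : IsUnitPath D x y f L) (hg : IsUnitPath D y z g M) :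
    qhInt D (concat f g L) 0 (L + M) = qhInt D f 0 L + qhInt D g 0 M := by
  have hL := hf.nonneg
  have hM := hg.nonneg
  rw [← (hf.trans hg).qhInt_add hD hne (t := L) ⟨le_rfl, by linarith⟩ ⟨hL, by linarith⟩
    ⟨by linarith, le_rfl⟩]
  congr 1
  · refine intervalIntegral.integral_congr fun u hu => ?_
    rw [uIcc_of_le hL] at hu
    simp only [concat_of_le hu.2]
  · rw [← qhInt_comp_add, add_sub_cancel_left]
    refine intervalIntegral.integral_congr fun u hu => ?_
    rw [uIcc_of_le hM] at hu
    simp only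
    rw [concat_of_ge (hf.right.trans hg.left.symm) (le_add_of_nonneg_left hu.1),
      add_sub_cancel_right]

/-- Removing the loops that arise when a segment is put in front of an arc. -/
theorem IsUnitPath.exists_injOn_concat_seg {p q : E n} (hf : IsUnitPath D p q (seg p q) (dist p q))
    (hg : IsUnitPath D q y g M) (hgi : InjOn g (Icc 0 M)) :
    ∃ h N, IsUnitPath D p y h N ∧ InjOn h (Icc 0 N) ∧
      qhInt D h 0 N ≤ qhInt D (seg p q) 0 (dist p q) + qhInt D g 0 M := by
  rcases eq_or_ne p q with rfl | hpq
  · exact ⟨g, M, hg, hgi, le_add_of_nonneg_left (qhInt_nonneg dist_nonneg)⟩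
  -- Cut at the first point of the segment that lies on the arc: keep the segment up to there and
  -- the arc from there on. A further coincidence would be an earlier hit.
  have hK : IsCompact (Icc 0 (dist p q) ∩ seg p q ⁻¹' (g '' Icc 0 M)) := by
    refine isCompact_Icc.of_isClosed_subset ?_ inter_subset_left
    exact hf.continuousOn.preimage_isClosed_of_isClosed isClosed_Icc
      (isCompact_Icc.image_of_continuousOn hg.continuousOn).isClosed
  obtain ⟨s, ⟨⟨hs, u, hu, hus⟩, hmin⟩⟩ := hK.exists_isLeast
    ⟨dist p q, ⟨dist_nonneg, le_rfl⟩, 0, ⟨le_rfl, hg.nonneg⟩, by rw [seg_dist, hg.left]⟩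
  have hf' : IsUnitPath D p (seg p q s) (seg p q) s := by
    simpa [seg_zero] using hf.sub le_rfl hs.1 hs.2
  have hg' : IsUnitPath D (seg p q s) y (fun w => g (w + u)) (M - u) := by
    simpa [hus, hg.right] using hg.sub hu.1 hu.2 le_rfl
  have hc : seg p q s = (fun w => g (w + u)) 0 := hg'.left.symm
  refine ⟨_, _, hf'.trans hg', ?_, ?_⟩
  · have cross : ∀ a ∈ Icc 0 (s + (M - u)), ∀ b ∈ Icc 0 (s + (M - u)), a ≤ s → s ≤ b →
        concat (seg p q) (fun w => g (w + u)) s a = concat (seg p q) (fun w => g (w + u)) s b →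
        a = b := by
      intro a ha b hb has hsb hab
      rw [concat_of_le has, concat_of_ge hc hsb] at hab
      have hbM : b - s + u ∈ Icc 0 M := ⟨by linarith [hu.1], by linarith [hb.2]⟩
      have hsa : s ≤ a := hmin ⟨⟨ha.1, has.trans hs.2⟩, b - s + u, hbM, hab.symm⟩
      obtain rfl : a = s := le_antisymm has hsa
      rw [← hus] at hab
      linarith [hgi hu hbM hab]
    intro a ha b hb hab
    rcases le_total a s with has | has <;> rcases le_total b s with hbs | hbs
    · rw [concat_of_le has, concat_of_le hbs] at hab
      exact injective_seg hpq hab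
    · exact cross a ha b hb has hbs hab
    · exact (cross b hb a ha hbs has hab.symm).symm
    · rw [concat_of_ge hc has, concat_of_ge hc hbs] at hab
      have := hgi (x₁ := a - s + u) (x₂ := b - s + u) ⟨by linarith [hu.1], by linarith [ha.2]⟩
        ⟨by linarith [hu.1], by linarith [hb.2]⟩ hab
      linarith
  · rw [hf'.qhInt_concat hD hne hg', qhInt_comp_add]
    rw [← hf.qhInt_add hD hne (t := s) ⟨le_rfl, dist_nonneg⟩ hs ⟨dist_nonneg, le_rfl⟩,
      ← hg.qhInt_add hD hne (t := u) ⟨le_rfl, hg.nonneg⟩ hu ⟨hg.nonneg, le_rfl⟩]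
    linarith [qhInt_nonneg (D := D) (f := seg p q) hs.2, qhInt_nonneg (D := D) (f := g) hu.1]

theorem IsUnitPath.qhInt_le_of_bdist_ge (h : IsUnitPath D x y f L) {s t m : ℝ} (hs : 0 ≤ s)
    (hst : s ≤ t) (ht : t ≤ L) (hm : 0 < m) (hb : ∀ u ∈ Icc s t, m ≤ bdist D (f u)) :
    qhInt D f s t ≤ (t - s) / m := by
  have : qhInt D f s t ≤ ∫ _ in s..t, 1 / m :=
    intervalIntegral.integral_mono_on hst (h.intervalIntegrable hD hne ⟨hs, hst.trans ht⟩
      ⟨hs.trans hst, ht⟩) intervalIntegrable_const fun u hu =>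
      one_div_le_one_div_of_le hm (hb u hu)
  rwa [intervalIntegral.integral_const, smul_eq_mul, mul_one_div] at this

theorem IsUnitPath.le_qhInt_of_bdist_le (h : IsUnitPath D x y f L) {s t m : ℝ} (hs : 0 ≤ s)
    (hst : s ≤ t) (ht : t ≤ L) (hb : ∀ u ∈ Icc s t, bdist D (f u) ≤ m) :
    (t - s) / m ≤ qhInt D f s t := by
  have : ∫ _ in s..t, 1 / m ≤ qhInt D f s t :=
    intervalIntegral.integral_mono_on hst intervalIntegrable_const
      (h.intervalIntegrable hD hne ⟨hs, hst.trans ht⟩ ⟨hs.trans hst, ht⟩) fun u hu =>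
      one_div_le_one_div_of_le
        (bdist_pos hD hne (h.mapsTo ⟨hs.trans hu.1, hu.2.trans ht⟩)) (hb u hu)
  rwa [intervalIntegral.integral_const, smul_eq_mul, mul_one_div] at this

/-- A segment joining two close points of a path has almost no larger quasihyperbolic length
than the part of the path between them. -/
theorem IsUnitPath.qhInt_seg_le (h : IsUnitPath D x y f L) {d s t : ℝ} (hs : 0 ≤ s)
    (hst : s ≤ t) (ht : t ≤ L) (hd : ∀ u ∈ Icc 0 L, d ≤ bdist D (f u)) (htd : t - s < d) :
    IsUnitPath D (f s) (f t) (seg (f s) (f t)) (dist (f s) (f t)) ∧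
      qhInt D (seg (f s) (f t)) 0 (dist (f s) (f t)) ≤
        (d + (t - s)) / (d - (t - s)) * qhInt D f s t := by
  have hds := hd s ⟨hs, hst.trans ht⟩
  have hdist := h.dist_le hs hst ht
  have hseg : ∀ u ∈ Icc 0 (dist (f s) (f t)), dist (f s) (seg (f s) (f t) u) ≤ t - s := by
    intro u hu
    rcases eq_or_ne (f s) (f t) with he | he
    · simp [seg, ← he, hst]
    · have := dist_seg_seg he 0 u
      rw [seg_zero, zero_sub, abs_neg, abs_of_nonneg hu.1] at this
      linarith [hu.2]
  have hu : IsUnitPath D (f s) (f t) (seg (f s) (f t)) (dist (f s) (f t)) :=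
    isUnitPath_seg fun u hu => ball_bdist_subset hD.1 (h.mapsTo ⟨hs, hst.trans ht⟩) (by
      rw [Metric.mem_ball']
      linarith [hseg u hu])
  refine ⟨hu, ?_⟩
  have h1 := hu.qhInt_le_of_bdist_ge hD hne le_rfl dist_nonneg le_rfl
    (m := bdist D (f s) - (t - s)) (by linarith) fun u hu => by
      linarith [hseg u hu, bdist_le_add_dist (D := D) (f s) (seg (f s) (f t) u)]
  have h2 := h.le_qhInt_of_bdist_le hD hne hs hst ht (m := bdist D (f s) + (t - s)) fun u hu => by
      have h3 := h.dist_le hs hu.1 (hu.2.trans ht)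
      rw [dist_comm] at h3
      linarith [bdist_le_add_dist (D := D) (f u) (f s), hu.2]
  have hpos : 0 < d - (t - s) := by linarith
  have h0 : 0 ≤ t - s := by linarith
  refine h1.trans (le_trans ?_ (mul_le_mul_of_nonneg_left h2
    (div_nonneg (by linarith) hpos.le)))
  -- With `r = t - s` and `δ = bdist D (f s)`, what remains is `(d - r)(δ + r) ≤ (d + r)(δ - r)`,
  -- which follows from `d ≤ δ`.
  rw [sub_zero, div_mul_div_comm, div_le_div_iff₀ (by linarith) (mul_pos hpos (by linarith))]
  have h4 : 0 ≤ bdist D (f s) - (t - s) := by linarith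
  calc dist (f s) (f t) * ((d - (t - s)) * (bdist D (f s) + (t - s)))
      ≤ (t - s) * ((d - (t - s)) * (bdist D (f s) + (t - s))) := by
        gcongr
        exact mul_nonneg hpos.le (by linarith)
    _ ≤ (t - s) * ((d + (t - s)) * (bdist D (f s) - (t - s))) := by
        refine mul_le_mul_of_nonneg_left ?_ h0
        linarith [mul_le_mul_of_nonneg_right hds h0]
    _ = _ := by ring

/-- The last `k` pieces of length `r` are replaced by chords, working backwards from `y`. Each new
chord is put in front of the arc already built and loops are removed, which only shortens. -/
theorem IsUnitPath.exists_injOn_aux (h : IsUnitPath D x y f L) {d r : ℝ} (hr : 0 ≤ r)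
    (hrd : r < d) (hd : ∀ u ∈ Icc 0 L, d ≤ bdist D (f u)) (k : ℕ) (hk : k * r ≤ L) :
    ∃ g M, IsUnitPath D (f (L - k * r)) y g M ∧ InjOn g (Icc 0 M) ∧
      qhInt D g 0 M ≤ (d + r) / (d - r) * qhInt D f (L - k * r) L := by
  induction k with
  | zero =>
    refine ⟨f ∘ fun s => s + L, 0, ?_, by simp, by simp [qhInt]⟩
    simpa [h.right, Function.comp_def] using h.sub h.nonneg le_rfl le_rfl
  | succ k ih =>
    push_cast at hk ⊢
    have hkr : 0 ≤ k * r := by positivity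
    obtain ⟨g, M, hg, hgi, hgq⟩ := ih (by linarith)
    obtain ⟨h1, h2⟩ := h.qhInt_seg_le hD hne (s := L - (k + 1) * r) (t := L - k * r)
      (by linarith) (by linarith) (by linarith) hd (by linarith)
    obtain ⟨g', M', hg', hgi', hgq'⟩ := h1.exists_injOn_concat_seg hD hne hg hgi
    refine ⟨g', M', hg', hgi', ?_⟩
    rw [← h.qhInt_add hD hne (t := L - k * r) ⟨by linarith, by linarith⟩
      ⟨by linarith, by linarith⟩ ⟨by linarith, by linarith⟩, mul_add]
    rw [show L - k * r - (L - (k + 1) * r) = r by ring] at h2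
    linarith

/-- Every path can be replaced by an arc of almost no larger quasihyperbolic length. -/
theorem IsUnitPath.exists_injOn (h : IsUnitPath D x y f L) {ε : ℝ} (hε : 0 < ε) :
    ∃ g M, IsUnitPath D x y g M ∧ InjOn g (Icc 0 M) ∧ qhInt D g 0 M ≤ qhInt D f 0 L + ε := by
  have hL := h.nonneg
  have hQ : 0 ≤ qhInt D f 0 L := qhInt_nonneg hL
  obtain ⟨u, hu, hmin⟩ := isCompact_Icc.exists_isMinOn ⟨0, ⟨le_rfl, hL⟩⟩
    (continuous_bdist (D := D) |>.comp_continuousOn h.continuousOn)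
  obtain ⟨d, hdu⟩ : ∃ d, d = bdist D (f u) := ⟨_, rfl⟩
  have hd' : ∀ v ∈ Icc 0 L, d ≤ bdist D (f v) := fun v hv => hdu ▸ hmin hv
  have hd : 0 < d := hdu ▸ bdist_pos hD hne (h.mapsTo hu)
  -- For pieces of length `r` below this minimum, `2 r Q + ε r ≤ ε d` with `Q = qhInt D f 0 L`,
  -- which says that the factor `(d + r)/(d - r)` costs at most `ε`.
  have hρ : 0 < min (d / 2) (ε * d / (4 * (qhInt D f 0 L + 1))) := by positivity
  obtain ⟨N, hN⟩ := exists_nat_gt (L / min (d / 2) (ε * d / (4 * (qhInt D f 0 L + 1))))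
  have hN0 : (0 : ℝ) < N := lt_of_le_of_lt (by positivity) hN
  have hr := (div_lt_iff₀ hρ).1 hN
  rw [mul_comm, ← div_lt_iff₀ hN0, lt_min_iff, lt_div_iff₀ (by positivity)] at hr
  have hr0 : 0 ≤ L / N := by positivity
  have hNr : N * (L / N) = L := by field_simp
  obtain ⟨g, M, hg, hgi, hgq⟩ := h.exists_injOn_aux hD hne hr0 (by linarith)
    hd' N hNr.le
  rw [hNr, sub_self] at hgq hg
  rw [h.left] at hg
  refine ⟨g, M, hg, hgi, hgq.trans ?_⟩
  rw [div_mul_eq_mul_div, div_le_iff₀ (by linarith)]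
  have := mul_le_mul_of_nonneg_left hr.1.le hε.le
  have := (lt_div_iff₀ (by positivity)).1 hr.2
  linarith

/-- Existence of arcs that are quasihyperbolically shortest up to an additive error. -/
theorem IsUnitPath.exists_injOn_almost_min (h : IsUnitPath D x y f L) {ε : ℝ} (hε : 0 < ε) :
    ∃ g M, IsUnitPath D x y g M ∧ InjOn g (Icc 0 M) ∧
      ∀ g' M', IsUnitPath D x y g' M' → qhInt D g 0 M ≤ qhInt D g' 0 M' + ε := by
  have hne' : {r | ∃ g M, IsUnitPath D x y g M ∧ qhInt D g 0 M = r}.Nonempty :=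
    ⟨_, f, L, h, rfl⟩
  obtain ⟨_, ⟨g, M, hg, rfl⟩, hlt⟩ := exists_lt_of_csInf_lt hne'
    (lt_add_of_pos_right _ (half_pos hε))
  obtain ⟨g', M', hg', hgi', hgq'⟩ := hg.exists_injOn hD hne (half_pos hε)
  refine ⟨g', M', hg', hgi', fun k K hk => ?_⟩
  have : sInf {r | ∃ g M, IsUnitPath D x y g M ∧ qhInt D g 0 M = r} ≤ qhInt D k 0 K :=
    csInf_le ⟨0, by rintro _ ⟨g, M, hg, rfl⟩; exact qhInt_nonneg hg.nonneg⟩ ⟨k, K, hk, rfl⟩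
  linarith

/-- Parts of almost shortest paths are almost shortest. -/
theorem IsUnitPath.qhInt_le_of_almost_min (h : IsUnitPath D x y f L) {ε : ℝ}
    (hmin : ∀ g M, IsUnitPath D x y g M → qhInt D f 0 L ≤ qhInt D g 0 M + ε) {s t : ℝ}
    (hs : 0 ≤ s) (hst : s ≤ t) (ht : t ≤ L) (hg : IsUnitPath D (f s) (f t) g M) :
    qhInt D f s t ≤ qhInt D g 0 M + ε := by
  have h1 : IsUnitPath D x (f s) (fun u => f (u + 0)) (s - 0) := by
    simpa [h.left] using h.sub le_rfl hs (hst.trans ht)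
  have h2 : IsUnitPath D (f t) y (fun u => f (u + t)) (L - t) := by
    simpa [h.right] using h.sub (hs.trans hst) ht le_rfl
  have h3 := hmin _ _ ((h1.trans hg).trans h2)
  rw [(h1.trans hg).qhInt_concat hD hne h2, h1.qhInt_concat hD hne hg, qhInt_comp_add,
    qhInt_comp_add] at h3
  have hL := h.nonneg
  rw [← h.qhInt_add hD hne (t := t) ⟨le_rfl, hL⟩ ⟨by linarith, ht⟩ ⟨hL, le_rfl⟩,
    ← h.qhInt_add hD hne (t := s) ⟨le_rfl, hL⟩ ⟨hs, by linarith⟩ ⟨by linarith, ht⟩] at h3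
  linarith

end

end HypMetric

/-! ### Real-variable lemmas -/

theorem ContinuousOn.exists_first_eq {g : ℝ → ℝ} {a b v : ℝ} (hg : ContinuousOn g (Icc a b))
    (hab : a ≤ b) (ha : g a ≤ v) (hb : v ≤ g b) :
    ∃ w ∈ Icc a b, g w = v ∧ ∀ u ∈ Icc a w, g u ≤ v := by
  have hK : IsCompact (Icc a b ∩ g ⁻¹' Ici v) := isCompact_Icc.of_isClosed_subset
    (hg.preimage_isClosed_of_isClosed isClosed_Icc isClosed_Ici) inter_subset_left
  obtain ⟨w, ⟨hw, hwv⟩, hmin⟩ := hK.exists_isLeast ⟨b, ⟨hab, le_rfl⟩, hb⟩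
  obtain ⟨u, hu, huv⟩ := intermediate_value_Icc hw.1 (hg.mono (Icc_subset_Icc le_rfl hw.2))
    ⟨ha, hwv⟩
  have huw : w ≤ u := hmin ⟨⟨hu.1, hu.2.trans hw.2⟩, huv.ge⟩
  obtain rfl := le_antisymm hu.2 huw
  refine ⟨u, hw, huv, fun r hr => ?_⟩
  by_contra! hlt
  obtain rfl := le_antisymm hr.2 (hmin ⟨⟨hr.1, hr.2.trans hw.2⟩, hlt.le⟩)
  exact hlt.ne' huv

theorem integral_one_div_const_add {a s : ℝ} (ha : 0 < a) (hs : 0 ≤ s) :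
    ∫ w in (0 : ℝ)..s, 1 / (a + w) = Real.log (1 + s / a) := by
  rw [intervalIntegral.integral_comp_add_left (fun w => 1 / w), add_zero,
    integral_one_div_of_pos ha (by linarith), add_div, div_self ha.ne']

/-- The solutions of `X ≤ c log (1 + 2 X) + 1` are bounded. -/
theorem le_of_le_mul_log_add_one {c X : ℝ} (hc : 1 ≤ c) (hX : 0 ≤ X)
    (h : X ≤ c * Real.log (1 + 2 * X) + 1) : X ≤ 2 * c * Real.log (4 * c) + 3 := by
  -- The scaling by `4c` leaves `X / 2` on the right, to be absorbed on the left.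
  have h1 := Real.log_le_sub_one_of_pos (x := (1 + 2 * X) / (4 * c)) (by positivity)
  rw [Real.log_div (by positivity) (by positivity)] at h1
  have h2 := mul_le_mul_of_nonneg_left h1 (by linarith : 0 ≤ c)
  have h3 : c * ((1 + 2 * X) / (4 * c) - 1) = (1 + 2 * X) / 4 - c := by field_simp
  rw [h3] at h2
  linarith

/-! ### Quasigeodesics: Harnack inequality, cone condition, quasiconvexity -/

namespace HypMetric
variable {n : ℕ} {D : Set (E n)} {x y z : E n} {f g : ℝ → E n} {L M : ℝ}

theorem jDist_comm (x y : E n) : jDist D x y = jDist D y x := by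
  rw [jDist, jDist, dist_comm, mul_comm (1 + _)]

theorem jDist_le {R a b : ℝ} (hR : dist x y ≤ R) (ha : 0 < a) (hb : 0 < b)
    (hax : a ≤ bdist D x) (hby : b ≤ bdist D y) :
    jDist D x y ≤ 1 / 2 * (Real.log (1 + R / a) + Real.log (1 + R / b)) := by
  have h0 : 0 ≤ dist x y := dist_nonneg
  have hx := ha.trans_le hax
  have hy := hb.trans_le hby
  have hR0 := h0.trans hR
  rw [jDist, Real.log_mul (by positivity) (by positivity)]
  gcongr

theorem jDist_pos (hxy : x ≠ y) (hx : 0 < bdist D x) (hy : 0 < bdist D y) : 0 < jDist D x y := by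
  have h0 : 0 < dist x y := dist_pos.2 hxy
  rw [jDist, Real.log_mul (by positivity) (by positivity)]
  have h1 := Real.log_pos (x := 1 + dist x y / bdist D x) (by simp; positivity)
  have h2 := Real.log_pos (x := 1 + dist x y / bdist D y) (by simp; positivity)
  linarith

theorem IsUnitPath.symm (h : IsUnitPath D x y f L) : IsUnitPath D y x (fun u => f (L - u)) L where
  nonneg := h.nonneg
  unitSpeed := by
    rw [hasUnitSpeedOn_Icc_iff]
    intro u v hu huv hv
    have h1 := eVariationOn.comp_eq_of_antitoneOn f (t := Icc u v) (fun w => L - w)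
      (fun a _ b _ hab => sub_le_sub_left hab L)
    rw [image_const_sub_Icc] at h1
    have h2 := h.pathLength_eq (s := L - v) (t := L - u) (by linarith) (by linarith) (by linarith)
    rw [show v - u = L - u - (L - v) by ring, ← h2, pathLength, ← h1]
    rfl
  mapsTo := fun u hu => h.mapsTo ⟨by linarith [hu.2], by linarith [hu.1]⟩
  left := by simp [h.right]
  right := by simp [h.left]

theorem qhInt_comp_sub (L s t : ℝ) :
    qhInt D (fun u => f (L - u)) s t = qhInt D f (L - t) (L - s) := by
  rw [qhInt, intervalIntegral.integral_comp_sub_left (fun u => 1 / bdist D (f u)), qhInt]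

/-- The quasihyperbolic length of the parts of `f` is controlled by the distance ratio metric. -/
def IsQuasiGeodesic (D : Set (E n)) (f : ℝ → E n) (L c : ℝ) : Prop :=
  ∀ ⦃s t⦄, 0 ≤ s → s ≤ t → t ≤ L → qhInt D f s t ≤ c * jDist D (f s) (f t) + 1

theorem IsQuasiGeodesic.symm {c : ℝ} (h : IsQuasiGeodesic D f L c) :
    IsQuasiGeodesic D (fun u => f (L - u)) L c := by
  intro s t hs hst ht
  rw [qhInt_comp_sub, jDist_comm]
  exact h (by linarith) (by linarith) (by linarith)

section
variable (hD : IsDomainSet D) (hne : D ≠ univ)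
include hD hne

theorem IsUnitPath.bdist_pos (h : IsUnitPath D x y f L) {s : ℝ} (hs : s ∈ Icc 0 L) :
    0 < bdist D (f s) := HypMetric.bdist_pos hD hne (h.mapsTo hs)

/-- As `δ_D` is 1-Lipschitz, `δ_D(f (v + w)) ≤ δ_D(f v) + w`; integrating the reciprocals gives `log
(1 + (u - v)/δ_D(f v)) ≤ qhInt D f v u`. -/
theorem IsUnitPath.bdist_le_mul_exp_of_ge (h : IsUnitPath D x y f L) {u v : ℝ} (hv : 0 ≤ v)
    (hvu : v ≤ u) (hu : u ≤ L) :
    bdist D (f u) ≤ bdist D (f v) * Real.exp (qhInt D f v u) := by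
  have hpos := h.bdist_pos hD hne ⟨hv, hvu.trans hu⟩
  have hposu := h.bdist_pos hD hne ⟨hv.trans hvu, hu⟩
  have h1 : ∫ w in (0 : ℝ)..(u - v), 1 / (bdist D (f v) + w) ≤ qhInt D f v u := by
    rw [← qhInt_comp_add]
    refine intervalIntegral.integral_mono_on (by linarith) ?_
      ((h.sub hv hvu hu).intervalIntegrable hD hne ⟨le_rfl, by linarith⟩ ⟨by linarith, le_rfl⟩) ?_
    · refine ContinuousOn.intervalIntegrable ?_
      rw [uIcc_of_le (by linarith)]
      exact continuousOn_const.div (by fun_prop) fun w hw => by linarith [hw.1]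
    · intro w hw
      have h2 := h.dist_le hv (le_add_of_nonneg_left hw.1) (by linarith [hw.2])
      refine one_div_le_one_div_of_le
        (h.bdist_pos hD hne ⟨by linarith [hw.1], by linarith [hw.2]⟩) ?_
      rw [dist_comm] at h2
      linarith [bdist_le_add_dist (D := D) (f (w + v)) (f v)]
  rw [integral_one_div_const_add hpos (by linarith)] at h1
  have h3 := Real.exp_le_exp.2 h1
  rw [Real.exp_log (by have : 0 ≤ u - v := by linarith
                       positivity)] at h3
  have h4 := mul_le_mul_of_nonneg_left h3 hpos.le
  rw [mul_add, mul_one, mul_div_cancel₀ _ hpos.ne'] at h4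
  have h2 := h.dist_le hv hvu hu
  rw [dist_comm] at h2
  linarith [bdist_le_add_dist (D := D) (f u) (f v)]

theorem IsUnitPath.qhInt_mono (h : IsUnitPath D x y f L) {s t s' t' : ℝ} (hs : 0 ≤ s)
    (hss : s ≤ s') (hst : s' ≤ t') (htt : t' ≤ t) (ht : t ≤ L) :
    qhInt D f s' t' ≤ qhInt D f s t := by
  rw [← h.qhInt_add hD hne (s := s) (t := s') (u := t) ⟨hs, by linarith⟩ ⟨by linarith, by linarith⟩
    ⟨by linarith, ht⟩, ← h.qhInt_add hD hne (s := s') (t := t') (u := t)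
    ⟨by linarith, by linarith⟩ ⟨by linarith, by linarith⟩ ⟨by linarith, ht⟩]
  linarith [qhInt_nonneg (D := D) (f := f) hss, qhInt_nonneg (D := D) (f := f) htt]

/-- The Harnack inequality for the distance to the boundary. -/
theorem IsUnitPath.bdist_le_mul_exp (h : IsUnitPath D x y f L) {s t u v : ℝ} (hs : 0 ≤ s)
    (ht : t ≤ L) (hu : u ∈ Icc s t) (hv : v ∈ Icc s t) :
    bdist D (f u) ≤ bdist D (f v) * Real.exp (qhInt D f s t) := by
  rcases le_total v u with hvu | huv
  · refine (h.bdist_le_mul_exp_of_ge hD hne (hs.trans hv.1) hvu (hu.2.trans ht)).trans ?_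
    gcongr
    · exact bdist_nonneg
    · exact h.qhInt_mono hD hne hs hv.1 hvu hu.2 ht
  · have h1 := h.symm.bdist_le_mul_exp_of_ge hD hne (v := L - v) (u := L - u)
      (by linarith [hv.2]) (by linarith) (by linarith [hu.1])
    rw [qhInt_comp_sub] at h1
    simp only [sub_sub_cancel] at h1
    refine h1.trans ?_
    gcongr
    · exact bdist_nonneg
    · exact h.qhInt_mono hD hne hs hu.1 huv hv.2 ht

omit hD hne in
theorem IsUnitPath.continuousOn_bdist (h : IsUnitPath D x y f L) :
    ContinuousOn (fun u => bdist D (f u)) (Icc 0 L) :=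
  continuous_bdist.comp_continuousOn h.continuousOn

/-- On a part of a quasigeodesic on which the distance to the boundary is, up to a factor `2`,
largest at the endpoints, lengths are bounded. -/
theorem IsUnitPath.length_le_of_bdist_le (h : IsUnitPath D x y f L) {c K : ℝ} (hc : 0 ≤ c)
    (hq : IsQuasiGeodesic D f L c)
    (hK : ∀ X, 0 ≤ X → X ≤ c * Real.log (1 + 2 * X) + 1 → X ≤ K) {s t m : ℝ} (hs : 0 ≤ s)
    (hst : s ≤ t) (ht : t ≤ L) (hm : 0 < m) (hb : ∀ u ∈ Icc s t, bdist D (f u) ≤ m)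
    (hms : m ≤ 2 * bdist D (f s)) (hmt : m ≤ 2 * bdist D (f t)) :
    t - s ≤ K * m ∧ qhInt D f s t ≤ c * Real.log (1 + 2 * K) + 1 := by
  have h1 := h.le_qhInt_of_bdist_le hD hne hs hst ht hb
  have h2 := jDist_le (D := D) (h.dist_le hs hst ht) (half_pos hm) (half_pos hm)
    (by linarith) (by linarith)
  rw [show (t - s) / (m / 2) = 2 * ((t - s) / m) by field_simp] at h2
  have h3 : c * jDist D (f s) (f t) ≤ c * Real.log (1 + 2 * ((t - s) / m)) :=
    mul_le_mul_of_nonneg_left (by linarith) hc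
  have h4 := hq hs hst ht
  have h0 : 0 ≤ (t - s) / m := div_nonneg (by linarith) hm.le
  have h5 := hK _ h0 (by linarith)
  refine ⟨(div_le_iff₀ hm).1 h5, h4.trans ?_⟩
  have : c * Real.log (1 + 2 * ((t - s) / m)) ≤ c * Real.log (1 + 2 * K) := by gcongr
  linarith

/-- Go back to the first `w` where `δ_D` is half of its value at `s`. The piece from `w` to `s` has
length at most `K δ_D(f s)`, and by induction `w ≤ 2K δ_D(f w) = K δ_D(f s)`. The number `N` of
halvings does not enter the bound. -/
theorem IsUnitPath.le_of_bdist_isMax (h : IsUnitPath D x y f L) {c K : ℝ} (hc : 0 ≤ c)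
    (hK0 : 0 ≤ K) (hq : IsQuasiGeodesic D f L c)
    (hK : ∀ X, 0 ≤ X → X ≤ c * Real.log (1 + 2 * X) + 1 → X ≤ K) (N : ℕ) {s : ℝ}
    (hs : s ∈ Icc 0 L) (hmax : ∀ u ∈ Icc 0 s, bdist D (f u) ≤ bdist D (f s))
    (hN : bdist D (f s) ≤ 2 ^ N * bdist D (f 0)) : s ≤ 2 * K * bdist D (f s) := by
  have hpos := h.bdist_pos hD hne hs
  have hhalf : bdist D (f s) ≤ 2 * bdist D (f 0) → s ≤ 2 * K * bdist D (f s) := by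
    intro h0
    have := (h.length_le_of_bdist_le hD hne hc hq hK le_rfl hs.1 hs.2 hpos hmax h0
      (by linarith)).1
    linarith [mul_nonneg hK0 hpos.le]
  induction N generalizing s with
  | zero =>
    rw [pow_zero, one_mul] at hN
    exact hhalf (by linarith)
  | succ N ih =>
    by_cases h0 : bdist D (f s) ≤ 2 * bdist D (f 0)
    · exact hhalf h0
    · obtain ⟨w, hw, hwv, hwmax⟩ := ((h.continuousOn_bdist (D := D)).mono
        (Icc_subset_Icc le_rfl hs.2)).exists_first_eq (v := bdist D (f s) / 2) hs.1
        (by linarith) (by linarith)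
      have hwL : w ∈ Icc 0 L := ⟨hw.1, hw.2.trans hs.2⟩
      have hwpos := h.bdist_pos hD hne hwL
      have hwm : ∀ u ∈ Icc 0 w, bdist D (f u) ≤ bdist D (f w) := fun u hu => hwv ▸ hwmax u hu
      have h1 := ih hwL hwm (by rw [pow_succ] at hN; linarith) hwpos fun h0 => by
        have := (h.length_le_of_bdist_le hD hne hc hq hK le_rfl hw.1 hwL.2 hwpos hwm h0
          (by linarith)).1
        linarith [mul_nonneg hK0 hwpos.le]
      have h2 := (h.length_le_of_bdist_le hD hne hc hq hK hw.1 hw.2 hs.2 hpos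
        (fun u hu => hmax u ⟨hw.1.trans hu.1, hu.2⟩) (by linarith) (by linarith)).1
      rw [hwv] at h1
      linarith

/-- Let `r` maximize `δ_D` on `[0, s]`, and let `w ≥ s` be the first time this value is attained
again, which happens before `T`. Then `r ≤ 2K δ_D(f r)` and `w - r ≤ K δ_D(f r)`, while Harnack on
`[r, w]` compares `δ_D(f r)` with `δ_D(f s)`. -/
theorem IsUnitPath.cone_left (h : IsUnitPath D x y f L) {c K : ℝ} (hc : 0 ≤ c)
    (hK0 : 0 ≤ K) (hq : IsQuasiGeodesic D f L c)
    (hK : ∀ X, 0 ≤ X → X ≤ c * Real.log (1 + 2 * X) + 1 → X ≤ K) {s T : ℝ}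
    (hT : T ∈ Icc 0 L) (hmax : ∀ u ∈ Icc 0 L, bdist D (f u) ≤ bdist D (f T)) (hs : s ∈ Icc 0 T) :
    s ≤ 3 * K * Real.exp (c * Real.log (1 + 2 * K) + 1) * bdist D (f s) := by
  have hcont := h.continuousOn_bdist (D := D)
  have hsL : s ≤ L := hs.2.trans hT.2
  obtain ⟨r, hr, hrmax⟩ := isCompact_Icc.exists_isMaxOn ⟨0, ⟨le_rfl, hs.1⟩⟩
    (hcont.mono (Icc_subset_Icc le_rfl hsL))
  replace hrmax : ∀ u ∈ Icc 0 s, bdist D (f u) ≤ bdist D (f r) := fun u hu => hrmax hu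
  have hrL : r ∈ Icc 0 L := ⟨hr.1, hr.2.trans hsL⟩
  have hpos := h.bdist_pos hD hne hrL
  have hpos0 := h.bdist_pos hD hne ⟨le_rfl, h.nonneg⟩
  obtain ⟨N, hN⟩ := pow_unbounded_of_one_lt (bdist D (f r) / bdist D (f 0)) (one_lt_two (α := ℝ))
  have h1 := h.le_of_bdist_isMax hD hne hc hK0 hq hK N hrL
    (fun u hu => hrmax u ⟨hu.1, hu.2.trans hr.2⟩) ((div_le_iff₀ hpos0).1 hN.le)
  obtain ⟨w, hw, hwv, hwmax⟩ := (hcont.mono (Icc_subset_Icc hs.1 hT.2)).exists_first_eq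
    (v := bdist D (f r)) hs.2 (hrmax s ⟨hs.1, le_rfl⟩) (hmax r hrL)
  obtain ⟨h2, h3⟩ := h.length_le_of_bdist_le hD hne hc hq hK hr.1 (hr.2.trans hw.1)
    (hw.2.trans hT.2) hpos (fun u hu => by
      rcases le_total u s with hus | hsu
      · exact hrmax u ⟨hr.1.trans hu.1, hus⟩
      · exact hwmax u ⟨hsu, hu.2⟩) (by linarith) (by linarith)
  have h4 := h.bdist_le_mul_exp hD hne (s := r) (t := w) (u := r) (v := s) hr.1
    (hw.2.trans hT.2) ⟨le_rfl, hr.2.trans hw.1⟩ ⟨hr.2, hw.1⟩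
  have h5 : bdist D (f r) ≤ bdist D (f s) * Real.exp (c * Real.log (1 + 2 * K) + 1) := by
    refine h4.trans ?_
    gcongr
    exact bdist_nonneg
  have h6 := mul_le_mul_of_nonneg_left h5 (by positivity : 0 ≤ 3 * K)
  linarith [hw.1]

theorem IsUnitPath.cone_right (h : IsUnitPath D x y f L) {c K : ℝ} (hc : 0 ≤ c)
    (hK0 : 0 ≤ K) (hq : IsQuasiGeodesic D f L c)
    (hK : ∀ X, 0 ≤ X → X ≤ c * Real.log (1 + 2 * X) + 1 → X ≤ K) {s T : ℝ}
    (hT : T ∈ Icc 0 L) (hmax : ∀ u ∈ Icc 0 L, bdist D (f u) ≤ bdist D (f T)) (hs : s ∈ Icc T L) :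
    L - s ≤ 3 * K * Real.exp (c * Real.log (1 + 2 * K) + 1) * bdist D (f s) := by
  have := h.symm.cone_left hD hne hc hK0 hq.symm hK (s := L - s) (T := L - T)
    ⟨by linarith [hT.2], by linarith [hT.1]⟩
    (fun u hu => by
      simpa using hmax (L - u) ⟨by linarith [hu.2], by linarith [hu.1]⟩)
    ⟨by linarith [hs.2], by linarith [hs.1]⟩
  simpa using this

/-- For close points `j_D ≤ 2 |x - y| / δ_D(x) ≤ 1`. So `δ_D ≤ e^c δ_D(x)` along the path, which
turns the bound on `qhInt` into one on length. A purely multiplicative bound is needed here: an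
additive error would not vanish with `|x - y|`. -/
theorem IsUnitPath.length_le_of_dist_le (h : IsUnitPath D x y f L) {c : ℝ} (hc : 0 ≤ c)
    (hq : qhInt D f 0 L ≤ c * jDist D x y) (hxy : 2 * dist x y ≤ bdist D x) :
    L ≤ 2 * c * Real.exp c * dist x y := by
  have hx : 0 < bdist D x := h.left ▸ h.bdist_pos hD hne ⟨le_rfl, h.nonneg⟩
  have hy := bdist_le_add_dist (D := D) x y
  have hR : 0 ≤ dist x y := dist_nonneg
  have h1 := jDist_le (D := D) (x := x) (y := y) le_rfl hx (half_pos hx) le_rfl (by linarith)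
  have h2 := Real.log_le_sub_one_of_pos (x := 1 + dist x y / bdist D x) (by positivity)
  have h3 := Real.log_le_sub_one_of_pos (x := 1 + dist x y / (bdist D x / 2)) (by positivity)
  have h4 : dist x y / (bdist D x / 2) = 2 * (dist x y / bdist D x) := by field_simp
  rw [h4] at h1 h3
  have h5 : dist x y / bdist D x ≤ 1 / 2 := by
    rw [div_le_div_iff₀ hx two_pos]
    linarith
  have h0 : 0 ≤ dist x y / bdist D x := by positivity
  have h6 : qhInt D f 0 L ≤ c * (2 * (dist x y / bdist D x)) :=
    hq.trans (mul_le_mul_of_nonneg_left (by linarith) hc)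
  have h7 : qhInt D f 0 L ≤ c := hq.trans (by nlinarith)
  have h8 := h.le_qhInt_of_bdist_le hD hne le_rfl h.nonneg le_rfl
    (m := bdist D x * Real.exp c) fun u hu => by
      have := h.bdist_le_mul_exp hD hne le_rfl le_rfl hu ⟨le_rfl, h.nonneg⟩
      rw [h.left] at this
      refine this.trans ?_
      gcongr
  rw [sub_zero, div_le_iff₀ (by positivity)] at h8
  refine h8.trans ((mul_le_mul_of_nonneg_right h6 (by positivity)).trans_eq ?_)
  field_simp

theorem IsUnitPath.length_le (h : IsUnitPath D x y f L) {c C : ℝ} (hc : 0 ≤ c) (hC : 0 ≤ C)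
    (hqg : IsQuasiGeodesic D f L c) {T : ℝ} (hT : T ∈ Icc 0 L)
    (hleft : ∀ s ∈ Icc 0 T, s ≤ C * bdist D (f s))
    (hright : ∀ s ∈ Icc T L, L - s ≤ C * bdist D (f s))
    (hxR : bdist D x ≤ 2 * dist x y) (hyR : bdist D y ≤ 2 * dist x y) :
    L ≤ (4 * C + 2 * ((c * Real.log (1 + (1 + 4 * C) / 2) + 1) *
      Real.exp (c * Real.log (1 + (1 + 4 * C) / 2) + 1))) * dist x y := by
  have hx : 0 < bdist D x := h.left ▸ h.bdist_pos hD hne ⟨le_rfl, h.nonneg⟩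
  have hR : 0 < dist x y := by linarith
  obtain ⟨B, hB⟩ : ∃ B, B = c * Real.log (1 + (1 + 4 * C) / 2) + 1 := ⟨_, rfl⟩
  have hB0 : 0 ≤ B := by
    have : 0 ≤ Real.log (1 + (1 + 4 * C) / 2) := Real.log_nonneg (by linarith)
    rw [hB]
    positivity
  rw [← hB]
  rcases le_total (bdist D (f T)) (2 * dist x y) with hTR | hTR
  · have h1 := hleft T ⟨hT.1, le_rfl⟩
    have h2 := hright T ⟨le_rfl, hT.2⟩
    have h3 := mul_le_mul_of_nonneg_left hTR hC
    have h4 : 0 ≤ B * Real.exp B * dist x y := by positivity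
    linarith
  -- Choose `s ≤ T ≤ t` where `δ_D` equals `2 |x - y|`. The end pieces have length at most `2C |x -
  -- y|` each, so `f s` and `f t` are at distance at most `(1 + 4C) |x - y|`, and `qhInt` between
  -- them is at most `B`.
  · have hcont := h.continuousOn_bdist (D := D)
    obtain ⟨s, hs, hsR⟩ := intermediate_value_Icc hT.1 (hcont.mono (Icc_subset_Icc le_rfl hT.2))
      (show 2 * dist x y ∈ Icc (bdist D (f 0)) _ from ⟨by rwa [h.left], hTR⟩)
    obtain ⟨t, ht, htR⟩ := intermediate_value_Icc' hT.2 (hcont.mono (Icc_subset_Icc hT.1 le_rfl))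
      (show 2 * dist x y ∈ Icc (bdist D (f L)) _ from ⟨by rwa [h.right], hTR⟩)
    simp only at hsR htR
    have hst : s ≤ t := hs.2.trans ht.1
    have h1 := hleft s hs
    have h2 := hright t ht
    rw [hsR] at h1
    rw [htR] at h2
    have h3 : dist (f s) (f t) ≤ (1 + 4 * C) * dist x y := by
      have h4 := h.dist_le le_rfl hs.1 (hst.trans ht.2)
      have h5 := h.dist_le (hs.1.trans hst) ht.2 le_rfl
      rw [h.left] at h4
      rw [h.right] at h5
      have := dist_triangle4 (f s) x y (f t)
      rw [dist_comm (f s) x, dist_comm y (f t)] at this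
      linarith
    have h4 := jDist_le (D := D) h3 (a := 2 * dist x y) (b := 2 * dist x y) (by positivity)
      (by positivity) hsR.ge htR.ge
    rw [show (1 + 4 * C) * dist x y / (2 * dist x y) = (1 + 4 * C) / 2 by field_simp] at h4
    have h5 : qhInt D f s t ≤ B := by
      refine (hqg hs.1 hst ht.2).trans ?_
      rw [hB]
      gcongr
      linarith
    have h6 := h.le_qhInt_of_bdist_le hD hne hs.1 hst ht.2
      (m := 2 * dist x y * Real.exp B) fun u hu => by
        have := h.bdist_le_mul_exp hD hne hs.1 ht.2 hu ⟨le_rfl, hst⟩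
        rw [hsR] at this
        refine this.trans ?_
        gcongr
    rw [div_le_iff₀ (by positivity)] at h6
    have h7 := h6.trans (mul_le_mul_of_nonneg_right h5 (by positivity))
    linarith

end

end HypMetric

/-! ### The two implications -/

theorem Real.log_one_add_mul_le {c t : ℝ} (hc : 1 ≤ c) (ht : 0 ≤ t) :
    Real.log (1 + c * t) ≤ c * Real.log (1 + t) := by
  rw [← Real.log_rpow (by linarith)]
  exact Real.log_le_log (by positivity)
    (one_add_mul_self_le_rpow_one_add (by linarith) hc)

namespace HypMetric
variable {n : ℕ} {D : Set (E n)} {x y z : E n} {f g : ℝ → E n} {L M : ℝ}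

theorem IsRectPath.lineIntegral_eq {a b : ℝ} (h : IsRectPath D x y f a b) (ρ : E n → ℝ) :
    lineIntegral ρ f a b = lineIntegral ρ (naturalParameterization f (Icc a b) a) 0
      (pathLength f a b).toReal := by
  rw [h.isUnitPath.lineIntegral_eq, lineIntegral]

theorem IsRectPath.min_le {a b : ℝ} (h : IsRectPath D x y f a b) {C : ℝ}
    (hcone : ∀ t ∈ Icc a b,
      min (pathLength f a t) (pathLength f t b) ≤ ENNReal.ofReal (C * bdist D (f t)))
    (hC : 0 ≤ C) {s : ℝ} (hs : s ∈ Icc 0 (pathLength f a b).toReal) :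
    min s ((pathLength f a b).toReal - s) ≤
      C * bdist D (naturalParameterization f (Icc a b) a s) := by
  obtain ⟨t, ht, rfl⟩ := h.exists_eq_toReal hs
  rw [h.naturalParameterization_apply ht]
  have hadd : pathLength f a t + pathLength f t b = pathLength f a b := by
    simpa only [pathLength, univ_inter] using eVariationOn.Icc_add_Icc f ht.1 ht.2 (mem_univ t)
  have h1 : pathLength f a t ≠ ∞ := ne_top_of_le_ne_top h.rectifiable (hadd ▸ le_self_add)
  have h2 : pathLength f t b ≠ ∞ := ne_top_of_le_ne_top h.rectifiable (hadd ▸ le_add_self)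
  rw [← hadd, ENNReal.toReal_add h1 h2, add_sub_cancel_left]
  have h0 : 0 ≤ C * bdist D (f t) := mul_nonneg hC bdist_nonneg
  rcases min_le_iff.1 (hcone t ht) with h3 | h3
  · exact min_le_of_left_le (ENNReal.toReal_le_of_le_ofReal h0 h3)
  · exact min_le_of_right_le (ENNReal.toReal_le_of_le_ofReal h0 h3)

section
variable (hD : IsDomainSet D) (hne : D ≠ univ)
include hD hne

theorem IsUnitPath.qhInt_half_le (h : IsUnitPath D x y f L) {c R : ℝ} (hc : 1 ≤ c)
    (hcone : ∀ s ∈ Icc 0 (L / 2), s ≤ c * bdist D (f s)) (hL : L ≤ c * R) :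
    qhInt D f 0 (L / 2) ≤ (2 * c + 1) * c * Real.log (1 + R / bdist D x) := by
  have hL0 := h.nonneg
  have hx : 0 < bdist D x := h.left ▸ h.bdist_pos hD hne ⟨le_rfl, hL0⟩
  have hR : 0 ≤ R := nonneg_of_mul_nonneg_right (hL0.trans hL) (by linarith)
  have h1 : qhInt D f 0 (L / 2) ≤
      ∫ w in (0 : ℝ)..L / 2, (2 * c + 1) * (1 / (bdist D x + w)) := by
    refine intervalIntegral.integral_mono_on (by linarith)
      (h.intervalIntegrable hD hne ⟨le_rfl, hL0⟩ ⟨by linarith, by linarith⟩) ?_ ?_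
    · refine ContinuousOn.intervalIntegrable ?_
      rw [uIcc_of_le (by linarith)]
      exact continuousOn_const.mul (continuousOn_const.div (by fun_prop)
        fun w hw => by linarith [hw.1])
    · intro w hw
      have hwL : w ≤ L := by linarith [hw.2]
      have h2 := h.dist_le le_rfl hw.1 hwL
      have h3 := h.bdist_pos hD hne ⟨hw.1, hwL⟩
      rw [h.left] at h2
      rw [mul_one_div, div_le_div_iff₀ h3 (by linarith [hw.1])]
      nlinarith [hcone w hw, bdist_le_add_dist (D := D) x (f w)]
  rw [intervalIntegral.integral_const_mul, integral_one_div_const_add hx (by linarith)] at h1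
  refine h1.trans ?_
  rw [mul_assoc]
  refine mul_le_mul_of_nonneg_left ?_ (by linarith)
  refine le_trans ?_ (Real.log_one_add_mul_le hc (by positivity))
  rw [← mul_div_assoc]
  gcongr
  linarith

theorem IsUnitPath.qhInt_le_jDist (h : IsUnitPath D x y f L) {c : ℝ} (hc : 1 ≤ c)
    (hcone : ∀ s ∈ Icc 0 L, min s (L - s) ≤ c * bdist D (f s)) (hL : L ≤ c * dist x y) :
    qhInt D f 0 L ≤ 2 * ((2 * c + 1) * c) * jDist D x y := by
  have hL0 := h.nonneg
  have hx : 0 < bdist D x := h.left ▸ h.bdist_pos hD hne ⟨le_rfl, hL0⟩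
  have hy : 0 < bdist D y := h.right ▸ h.bdist_pos hD hne ⟨hL0, le_rfl⟩
  have h1 := h.qhInt_half_le hD hne hc (fun s hs => by
    have := hcone s ⟨hs.1, by linarith [hs.2]⟩
    rwa [min_eq_left (by linarith [hs.2])] at this) hL
  have h2 := h.symm.qhInt_half_le hD hne hc (fun s hs => by
    have := hcone (L - s) ⟨by linarith [hs.2], by linarith [hs.1]⟩
    rwa [min_eq_right (by linarith [hs.2]), sub_sub_cancel] at this) hL
  rw [qhInt_comp_sub, sub_zero, sub_half] at h2
  rw [← h.qhInt_add hD hne (t := L / 2) ⟨le_rfl, hL0⟩ ⟨by linarith, by linarith⟩ ⟨hL0, le_rfl⟩,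
    jDist, Real.log_mul (by positivity) (by positivity)]
  linarith

theorem IsUnitPath.lineIntegral_mDensity_le (hn : 1 ≤ n) (h : IsUnitPath D x y f L) :
    lineIntegral (mDensity D) f 0 L ≤ ENNReal.ofReal (2 * qhInt D f 0 L) := by
  rw [ENNReal.ofReal_mul zero_le_two, ← h.lineIntegral_one_div hD hne, h.lineIntegral_eq,
    h.lineIntegral_eq, ← lintegral_const_mul' _ _ ENNReal.ofReal_ne_top]
  refine setLIntegral_mono' measurableSet_Icc fun s hs => ?_
  rw [← ENNReal.ofReal_mul zero_le_two, mul_one_div]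
  exact ENNReal.ofReal_le_ofReal (mDensity_le hn hD hne (h.mapsTo hs))

theorem IsUnitPath.ofReal_qhInt_le (hn : 1 ≤ n) (h : IsUnitPath D x y f L) :
    ENNReal.ofReal (qhInt D f 0 L) ≤ lineIntegral (mDensity D) f 0 L := by
  rw [← h.lineIntegral_one_div hD hne, h.lineIntegral_eq, h.lineIntegral_eq]
  refine setLIntegral_mono' measurableSet_Icc fun s hs => ?_
  exact ENNReal.ofReal_le_ofReal (one_div_bdist_le_mDensity hn hD hne (h.mapsTo hs))

theorem exists_mDist_le_of_isUniform (hn : 1 ≤ n) (hu : IsUniform D) :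
    ∃ c₁ : ℝ, 1 ≤ c₁ ∧ ∀ x ∈ D, ∀ y ∈ D, mDist D x y ≤ ENNReal.ofReal (c₁ * jDist D x y) := by
  obtain ⟨c, hc, hu⟩ := hu
  refine ⟨4 * ((2 * c + 1) * c), by nlinarith, fun x hx y hy => ?_⟩
  obtain ⟨f, a, b, hf, -, hcone, hlen⟩ := hu x hx y hy
  have hc0 : 0 ≤ c := by linarith
  have h1 := hf.isUnitPath.qhInt_le_jDist hD hne hc (fun s hs => hf.min_le hcone hc0 hs)
    (ENNReal.toReal_le_of_le_ofReal (mul_nonneg hc0 dist_nonneg) hlen)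
  calc mDist D x y ≤ lineIntegral (mDensity D) f a b :=
        iInf_le_of_le f <| iInf_le_of_le a <| iInf_le_of_le b <| iInf_le _ hf
    _ ≤ _ := hf.lineIntegral_eq _ ▸ hf.isUnitPath.lineIntegral_mDensity_le hD hne hn
    _ ≤ _ := ENNReal.ofReal_le_ofReal (by linarith)

theorem exists_isUnitPath_of_mDist_lt (hn : 1 ≤ n) {r : ℝ}
    (h : mDist D x y < ENNReal.ofReal r) : ∃ f L, IsUnitPath D x y f L ∧ qhInt D f 0 L ≤ r := by
  simp only [mDist, iInf_lt_iff] at h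
  obtain ⟨f, a, b, hf, hlt⟩ := h
  refine ⟨_, _, hf.isUnitPath, ?_⟩
  rw [hf.lineIntegral_eq] at hlt
  exact ((ENNReal.ofReal_lt_ofReal_iff'.1
    ((hf.isUnitPath.ofReal_qhInt_le hD hne hn).trans_lt hlt)).1).le

theorem exists_isQuasiGeodesic (hn : 1 ≤ n) {c : ℝ} (hc : 1 ≤ c)
    (h : ∀ x ∈ D, ∀ y ∈ D, mDist D x y ≤ ENNReal.ofReal (c * jDist D x y))
    (hx : x ∈ D) (hy : y ∈ D) (hxy : x ≠ y) :
    ∃ f L, IsUnitPath D x y f L ∧ InjOn f (Icc 0 L) ∧ IsQuasiGeodesic D f L c ∧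
      qhInt D f 0 L ≤ (c + 1) * jDist D x y := by
  have hjnn : ∀ {x y : E n}, x ∈ D → y ∈ D → 0 ≤ jDist D x y := by
    intro x y hx hy
    rcases eq_or_ne x y with rfl | hxy
    · simp [jDist]
    · exact (jDist_pos hxy (bdist_pos hD hne hx) (bdist_pos hD hne hy)).le
  have hex : ∀ {x y : E n}, x ∈ D → y ∈ D → ∀ η > 0, ∃ g M, IsUnitPath D x y g M ∧
      qhInt D g 0 M ≤ c * jDist D x y + η := by
    intro x y hx hy η hη
    refine exists_isUnitPath_of_mDist_lt hD hne hn ((h x hx y hy).trans_lt ?_)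
    have := mul_nonneg (zero_le_one.trans hc) (hjnn hx hy)
    exact (ENNReal.ofReal_lt_ofReal_iff (by linarith)).2 (by linarith)
  have hj := jDist_pos hxy (bdist_pos hD hne hx) (bdist_pos hD hne hy)
  obtain ⟨f₀, L₀, hf₀, -⟩ := hex hx hy 1 one_pos
  -- The error is at most `1`, as quasigeodesics allow, and at most `j_D(x, y)`, so that for the
  -- whole arc it is absorbed into the factor `c + 1`.
  obtain ⟨f, L, hf, hinj, hmin⟩ := hf₀.exists_injOn_almost_min hD hne (lt_min one_pos hj)
  have key : ∀ s t, 0 ≤ s → s ≤ t → t ≤ L →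
      qhInt D f s t ≤ c * jDist D (f s) (f t) + min 1 (jDist D x y) := by
    intro s t hs hst ht
    refine le_of_forall_pos_le_add fun η hη => ?_
    obtain ⟨g, M, hg, hgq⟩ := hex (hf.mapsTo ⟨hs, hst.trans ht⟩)
      (hf.mapsTo ⟨hs.trans hst, ht⟩) η hη
    linarith [hf.qhInt_le_of_almost_min hD hne hmin hs hst ht hg]
  refine ⟨f, L, hf, hinj, fun s t hs hst ht => ?_, ?_⟩
  · linarith [key s t hs hst ht, min_le_left 1 (jDist D x y)]
  · have := key 0 L le_rfl hf.nonneg le_rfl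
    rw [hf.left, hf.right] at this
    linarith [min_le_right 1 (jDist D x y)]

theorem isUniform_of_mDist_le (hn : 1 ≤ n) {c : ℝ} (hc : 1 ≤ c)
    (h : ∀ x ∈ D, ∀ y ∈ D, mDist D x y ≤ ENNReal.ofReal (c * jDist D x y)) : IsUniform D := by
  have hc0 : 0 ≤ c := by linarith
  obtain ⟨K, hK0, hK⟩ : ∃ K : ℝ, 0 ≤ K ∧
      ∀ X, 0 ≤ X → X ≤ c * Real.log (1 + 2 * X) + 1 → X ≤ K := by
    have : 0 ≤ Real.log (4 * c) := Real.log_nonneg (by linarith)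
    exact ⟨2 * c * Real.log (4 * c) + 3, by positivity,
      fun X hX => le_of_le_mul_log_add_one hc hX⟩
  obtain ⟨C, hCdef⟩ : ∃ C, C = 3 * K * Real.exp (c * Real.log (1 + 2 * K) + 1) := ⟨_, rfl⟩
  have hC : 0 ≤ C := by rw [hCdef]; positivity
  obtain ⟨A, hA⟩ : ∃ A, A = 2 * (c + 1) * Real.exp (c + 1) := ⟨_, rfl⟩
  have hA0 : 0 ≤ A := by rw [hA]; positivity
  obtain ⟨B, hB⟩ : ∃ B, B = 4 * C + 2 * ((c * Real.log (1 + (1 + 4 * C) / 2) + 1) *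
      Real.exp (c * Real.log (1 + (1 + 4 * C) / 2) + 1)) := ⟨_, rfl⟩
  have hB0 : 0 ≤ B := by
    have : 0 ≤ Real.log (1 + (1 + 4 * C) / 2) := Real.log_nonneg (by linarith)
    rw [hB]
    positivity
  refine ⟨1 + C + A + B, by linarith, fun x hx y hy => ?_⟩
  rcases eq_or_ne x y with rfl | hxy
  -- The constant path on the degenerate interval `[0, 0]` is injective there.
  · have h0 : ∀ s t, pathLength (fun _ : ℝ => x) s t = 0 := fun s t =>
      eVariationOn.constant_on (by rintro _ ⟨_, _, rfl⟩ _ ⟨_, _, rfl⟩; rfl)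
    refine ⟨fun _ => x, 0, 0, ⟨le_rfl, continuousOn_const, fun _ _ => hx, rfl, rfl, ?_⟩, ?_, ?_, ?_⟩
    · simp [h0]
    · simp
    · simp [h0]
    · simp [h0]
  obtain ⟨f, L, hf, hinj, hqg, hq⟩ := exists_isQuasiGeodesic hD hne hn hc h hx hy hxy
  obtain ⟨T, hT, hmax⟩ := isCompact_Icc.exists_isMaxOn ⟨0, ⟨le_rfl, hf.nonneg⟩⟩
    (hf.continuousOn_bdist (D := D))
  have hleft : ∀ s ∈ Icc 0 T, s ≤ C * bdist D (f s) := fun s hs =>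
    hCdef ▸ hf.cone_left hD hne hc0 hK0 hqg hK hT (fun u hu => hmax hu) hs
  have hright : ∀ s ∈ Icc T L, L - s ≤ C * bdist D (f s) := fun s hs =>
    hCdef ▸ hf.cone_right hD hne hc0 hK0 hqg hK hT (fun u hu => hmax hu) hs
  refine ⟨f, 0, L, hf.isRectPath, hinj, fun s hs => ?_, ?_⟩
  · have hle : C * bdist D (f s) ≤ (1 + C + A + B) * bdist D (f s) :=
      mul_le_mul_of_nonneg_right (by linarith) bdist_nonneg
    rw [hf.pathLength_eq le_rfl hs.1 hs.2, hf.pathLength_eq hs.1 hs.2 le_rfl, min_le_iff, sub_zero]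
    rcases le_total s T with hsT | hTs
    · exact .inl (ENNReal.ofReal_le_ofReal ((hleft s ⟨hs.1, hsT⟩).trans hle))
    · exact .inr (ENNReal.ofReal_le_ofReal ((hright s ⟨hTs, hs.2⟩).trans hle))
  · rw [hf.pathLength_eq le_rfl hf.nonneg le_rfl, sub_zero]
    refine ENNReal.ofReal_le_ofReal ?_
    have hR : 0 ≤ dist x y := dist_nonneg
    have hAR := mul_nonneg hA0 hR
    have hBR := mul_nonneg hB0 hR
    have hCR := mul_nonneg hC hR
    rcases le_total (2 * dist x y) (bdist D x) with h1 | h1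
    · have := hf.length_le_of_dist_le hD hne (by linarith) hq h1
      rw [← hA] at this
      linarith
    rcases le_total (2 * dist x y) (bdist D y) with h2 | h2
    · have := hf.symm.length_le_of_dist_le hD hne (c := c + 1) (by linarith)
        (by rwa [qhInt_comp_sub, sub_self, sub_zero, jDist_comm]) (by rwa [dist_comm])
      rw [← hA, dist_comm] at this
      linarith
    · have := hf.length_le hD hne hc0 hC hqg hT hleft hright h1 h2
      rw [← hB] at this
      linarith

end

end HypMetric

theorem mainTheorem3 (n : ℕ) (hn : 2 ≤ n) (D : Set (HypMetric.E n))
    (hD : HypMetric.IsDomainSet D) (hproper : D ≠ Set.univ) :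
    HypMetric.IsUniform D ↔
      ∃ c₁ : ℝ, 1 ≤ c₁ ∧ ∀ x ∈ D, ∀ y ∈ D,
        HypMetric.mDist D x y ≤ ENNReal.ofReal (c₁ * HypMetric.jDist D x y) :=
  ⟨HypMetric.exists_mDist_le_of_isUniform hD hproper (one_le_two.trans hn),
    fun ⟨_, hc, h⟩ => HypMetric.isUniform_of_mDist_le hD hproper (one_le_two.trans hn) hc h⟩
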